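/- Let $d\ge 2$ and $n\ge d+2$. Let $p=(p_1,\dots,p_n)$ be a generic configuration of $n$ points in $\mathbb{R}^d$, that is, the $dn$ coordinates of $p$ satisfy no non-trivial polynomial equation with coefficients in $\mathbb{Q}$. An edge measurement ensemble on $m$ vertices is a finite sequence of edges (unordered pairs of distinct elements of $\{1,\dots,m\}$). For an ensemble $G=(G_1,\dots,G_k)$ on $n$ vertices, write $\langle G,p\rangle^2$ for the sequence of squared Euclidean lengths $|p_a-p_b|^2$ of the edges $G_t=\{a,b\}$, $1\le t\le k$. An ensemble $H$ on $n'$ vertices allows for trilateration (in dimension $d$) if $n'\ge d+2$ and, after some reordering of the vertices, (i) $H$ contains all $\binom{d+2}{2}$ edges on the vertices $1,\dots,d+2$, and (ii) for every $j$ with $d+2<j\le n'$, $H$ contains edges $\{i_1,j\},\dots,\{i_{d+1},j\}$ for some $d+1$ distinct vertices $i_1,\dots,i_{d+1}<j$. Let $G$ be any edge measurement ensemble on $n$ vertices, and let $v=\langle G,p\rangle^2$. Let $q=(q_1,\dots,q_{n'})$ be a configuration of $n'$ points in $\mathbb{R}^d$, no two of which coincide, and let $H$ be an edge measurement ensemble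 on $n'$ vertices that allows for trilateration. Suppose that $v^-=\langle H,q\rangle^2$ is a (possibly reordered) subsequence of $v$, and let $G^-$ be the corresponding subsequence of $G$; that is, for some injective map $J:\{1,\dots,k'\}\to\{1,\dots,k\}$, where $k'$ is the number of edges of $H$, one has $v^-_t=v_{J(t)}$ and $G^-_t=G_{J(t)}$ for all $t$. Let $S\subseteq\{1,\dots,n\}$ be the support of $G^-$, the set of all endpoints of edges of $G^-$. Then there is a bijection $\varphi:\{1,\dots,n'\}\to S$ such that some isometry $T$ of $\mathbb{R}^d$ satisfies $T(p_{\varphi(i)})=q_i$ for all $i$, and such that $\varphi$ carries $H$ to $G^-$ edge by edge: if $H_t=\{a,b\}$ then $G^-_t=\{\varphi(a),\varphi(b)\}$, for all $t$. -/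

import Mathlib

namespace UnlabeledTrilateration

/-- A configuration of `n` points in Euclidean `d`-space. -/
abbrev Configuration (d n : ℕ) := Fin n → EuclideanSpace ℝ (Fin d)

/-- A configuration is generic if its `n * d` real coordinates satisfy no non-trivial polynomial
equation with rational coefficients. -/
def IsGeneric {d n : ℕ} (p : Configuration d n) : Prop :=
  AlgebraicIndependent ℚ (fun x : Fin n × Fin d => p x.1 x.2)

/-- An edge of the complete graph on `n` vertices: an unordered pair of distinct vertices. -/
abbrev Edge (n : ℕ) := {e : Sym2 (Fin n) // ¬ e.IsDiag}

/-- An edge measurement ensemble: a finite sequence of `k` edges. -/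
abbrev EdgeEnsemble (n k : ℕ) := Fin k → Edge n

/-- The squared Euclidean length of an edge in a configuration. -/
noncomputable def sqLength {d n : ℕ} (p : Configuration d n) (e : Edge n) : ℝ :=
  Sym2.lift ⟨fun i j => dist (p i) (p j) ^ 2, fun i j => by simp only [dist_comm]⟩ e.1

/-- The data set `⟨G, p⟩²`: the sequence of squared lengths of the edges of `G`. -/
noncomputable def sqData {d n k : ℕ} (G : EdgeEnsemble n k) (p : Configuration d n) :
    Fin k → ℝ :=
  fun t => sqLength p (G t)

/-- The ensemble contains the edge joining `i` and `j`. -/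
def ContainsEdge {n k : ℕ} (H : EdgeEnsemble n k) (i j : Fin n) : Prop :=
  ∃ t, (H t).1 = s(i, j)

/-- The ensemble allows for trilateration in dimension `d`: after reordering the vertices by `σ`,
it contains all edges of a base `K_{d+2}` on the first `d + 2` vertices, and for each later vertex
`j` it contains edges joining `j` to at least `d + 1` distinct earlier vertices. -/
def AllowsTrilateration (d : ℕ) {n k : ℕ} (H : EdgeEnsemble n k) : Prop :=
  d + 2 ≤ n ∧ ∃ σ : Equiv.Perm (Fin n),
    (∀ i j : Fin n, i < j → (j : ℕ) < d + 2 → ContainsEdge H (σ i) (σ j)) ∧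
    (∀ j : Fin n, d + 2 ≤ (j : ℕ) →
      ∃ R : Finset (Fin n), R.card = d + 1 ∧
        ∀ i ∈ R, i < j ∧ ContainsEdge H (σ i) (σ j))

/-- The support of an ensemble: the vertices that are endpoints of at least one of its edges. -/
def support {n k : ℕ} (G : EdgeEnsemble n k) : Set (Fin n) :=
  {i | ∃ t, i ∈ (G t).1}

/-- Two families of points are congruent if an isometry of Euclidean space onto itself carries the
first to the second, point by point. -/
def AreCongruent {d : ℕ} {ι : Type*} (x y : ι → EuclideanSpace ℝ (Fin d)) : Prop :=
  ∃ T : EuclideanSpace ℝ (Fin d) ≃ᵢ EuclideanSpace ℝ (Fin d), ∀ i, T (x i) = y i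

end UnlabeledTrilateration

/-!
A Cayley–Menger determinant vanishes on the squared distances of any `d + 2` points in `d`-space.
If the squared distances of such points are the squared lengths of some edges of the generic
configuration `p`, this is a polynomial relation with rational coefficients between the coordinates
of `p`, so it holds identically: the edges satisfy the same relation in *every* configuration `x`
of `n` points (`IsGeneric.det_cayleyMenger_eq_zero`). Well-chosen configurations `x` then recover
the combinatorics of the edges.

* If the edges formed a `(d + 1)`-colourable graph, putting each colour at a vertex of a regular
  simplex would make all squared distances equal, and the Cayley–Menger determinant of a regular
  table does not vanish. A graph with at most `(d + 2).choose 2` edges that is not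
  `(d + 1)`-colourable is a complete graph on `d + 2` vertices
  (`exists_eq_complete_of_not_colorable`).
* Let `ab` be the edge assigned to the pair `ij`. Let `a` and `b` coincide and put the other
  vertices at a nearly regular simplex. A nearly regular table whose `ij` entry vanishes is singular
  only if its rows `i` and `j` agree (`row_eq_of_det_cayleyMenger_eq_zero`), so the edges assigned
  to `ik` and `jk` have equal lengths whatever the simplex is, which forces them to be `ac` and `bc`
  for some `c` (`IsGeneric.exists_triangle`). An injective edge map preserving triangles comes from
  a vertex map (`exists_vertex_map`).

Hence `d + 2` points whose distances all occur in `p` are congruent to points of `p`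
(`IsGeneric.exists_labels`). This labels the base of the trilateration. For each later vertex it
applies to that vertex and its `d + 1` neighbours, whose mutual distances occur in `p` by induction;
the new label extends the old ones because `d + 1 ≥ 3` labels are determined by their pairs, and the
position of the new point is determined because `d + 1` generic points are affinely independent.
Finally, distinct edges of `p` have distinct lengths, so the relabelling carries `H` to `G ∘ J`.
-/

namespace UnlabeledTrilateration

/-! ### Congruence of families with equal distances -/

/-- Families of points with the same pairwise distances are congruent: a linear isometry between
the spans of the difference vectors is well defined because a combination of differences has the
same norm on both sides, and it extends to the whole space. -/
lemma areCongruent_of_dist_eq {d : ℕ} {ι : Type*} {x y : ι → EuclideanSpace ℝ (Fin d)}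
    (h : ∀ i j, dist (x i) (x j) = dist (y i) (y j)) : AreCongruent x y := by
  rcases isEmpty_or_nonempty ι with hι | ⟨⟨o⟩⟩
  · exact ⟨IsometryEquiv.refl _, fun i => hι.elim i⟩
  let u : ι → EuclideanSpace ℝ (Fin d) := fun i => x i - x o
  let v : ι → EuclideanSpace ℝ (Fin d) := fun i => y i - y o
  have hin : ∀ i j, inner ℝ (u i) (u j) = inner ℝ (v i) (v j) := by
    intro i j
    have e1 := real_inner_eq_norm_mul_self_add_norm_mul_self_sub_norm_sub_mul_self_div_two
      (u i) (u j)
    have e2 := real_inner_eq_norm_mul_self_add_norm_mul_self_sub_norm_sub_mul_self_div_two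
      (v i) (v j)
    have a1 : u i - u j = x i - x j := by simp [u]
    have a2 : v i - v j = y i - y j := by simp [v]
    rw [e1, e2, a1, a2]
    simp only [u, v, ← dist_eq_norm, h]
  let A := Finsupp.linearCombination ℝ u
  let B := Finsupp.linearCombination ℝ v
  have hAB : ∀ c, ‖A c‖ = ‖B c‖ := by
    intro c
    have : inner ℝ (A c) (A c) = inner ℝ (B c) (B c) := by
      simp only [A, B, Finsupp.linearCombination_apply, Finsupp.sum, sum_inner, inner_sum,
        inner_smul_left, inner_smul_right, hin]
    rw [real_inner_self_eq_norm_sq, real_inner_self_eq_norm_sq] at this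
    exact (sq_eq_sq₀ (norm_nonneg _) (norm_nonneg _)).1 this
  obtain ⟨s, hs⟩ := LinearMap.exists_rightInverse_of_surjective A.rangeRestrict
    A.range_rangeRestrict
  have hs' : ∀ w : LinearMap.range A, A (s w) = w := fun w =>
    congrArg Subtype.val (LinearMap.congr_fun hs w)
  let L : LinearMap.range A →ₗᵢ[ℝ] EuclideanSpace ℝ (Fin d) :=
    { toLinearMap := B ∘ₗ s
      norm_map' := fun w => by
        rw [LinearMap.comp_apply, ← hAB, hs']; rfl }
  have hL : ∀ i, L.extend (u i) = v i := by
    intro i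
    have hu : A (Finsupp.single i 1) = u i := by simp [A]
    have hv : B (Finsupp.single i 1) = v i := by simp [B]
    have hmem : u i ∈ LinearMap.range A := ⟨_, hu⟩
    have h1 := L.extend_apply ⟨u i, hmem⟩
    have h2 : ‖B (s ⟨u i, hmem⟩ - Finsupp.single i 1)‖ = 0 := by
      rw [← hAB, map_sub, hs', hu]; simp
    rw [norm_eq_zero, map_sub, hv, sub_eq_zero] at h2
    exact h1.trans h2
  refine ⟨((IsometryEquiv.subRight (x o)).trans
    (L.extend.toLinearIsometryEquiv rfl).toIsometryEquiv).trans
    (IsometryEquiv.addRight (y o)), fun i => ?_⟩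
  change L.extend (u i) + y o = y i
  rw [hL]
  simp [v]

/-! ### The Cayley–Menger matrix -/

/-- The Cayley–Menger matrix of a table `W` of squared distances: `W` bordered by a row and a
column of ones, with `0` in the corner. -/
def cayleyMenger {ι R : Type*} [Zero R] [One R] (W : ι → ι → R) :
    Matrix (Unit ⊕ ι) (Unit ⊕ ι) R :=
  Matrix.fromBlocks 0 (Matrix.of fun _ _ => 1) (Matrix.of fun _ _ => 1) (Matrix.of W)

/-- The first coordinate of a kernel vector of the Cayley–Menger matrix is the negative of the
constant `c`. -/
lemma det_cayleyMenger_eq_zero_iff {ι : Type*} [Fintype ι] [DecidableEq ι] [Nonempty ι]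
    {W : ι → ι → ℝ} :
    (cayleyMenger W).det = 0 ↔
      ∃ y : ι → ℝ, y ≠ 0 ∧ ∑ i, y i = 0 ∧ ∃ c, ∀ i, ∑ j, W i j * y j = c := by
  rw [← Matrix.exists_mulVec_eq_zero_iff]
  constructor
  · rintro ⟨v, hv, h⟩
    have h0 := congrFun h (Sum.inl ())
    have h1 := fun i => congrFun h (Sum.inr i)
    simp [cayleyMenger, Matrix.mulVec, dotProduct] at h0 h1
    refine ⟨fun i => v (Sum.inr i), ?_, h0, -v (Sum.inl ()), fun i => by linarith [h1 i]⟩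
    intro hy
    apply hv
    have hy' : ∀ i, v (Sum.inr i) = 0 := fun i => congrFun hy i
    have := h1 (Classical.arbitrary ι)
    simp only [hy', mul_zero, Finset.sum_const_zero, add_zero] at this
    funext z
    rcases z with ⟨⟩ | i
    · exact this
    · exact hy' i
  · rintro ⟨y, hy, h0, c, hc⟩
    refine ⟨Sum.elim (fun _ => -c) y, ?_, ?_⟩
    · intro h
      exact hy (funext fun i => congrFun h (Sum.inr i))
    · funext z
      rcases z with ⟨⟩ | i
      · simp [cayleyMenger, Matrix.mulVec, dotProduct, h0]
      · simp [cayleyMenger, Matrix.mulVec, dotProduct, hc]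

/-- The coefficients `y` of an affine dependence `∑ yⱼ qⱼ = 0` satisfy
`∑ⱼ |qᵢ - qⱼ|² yⱼ = ∑ⱼ |qⱼ|² yⱼ`, which does not depend on `i`. -/
lemma det_cayleyMenger_of_not_affineIndependent {d : ℕ} {ι : Type*} [Fintype ι] [DecidableEq ι]
    [Nonempty ι] {q : ι → EuclideanSpace ℝ (Fin d)} (h : ¬ AffineIndependent ℝ q) :
    (cayleyMenger fun i j => dist (q i) (q j) ^ 2).det = 0 := by
  rw [affineIndependent_iff] at h
  push Not at h
  obtain ⟨s, w, hw0, hwq, e, hes, hwe⟩ := h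
  rw [det_cayleyMenger_eq_zero_iff]
  refine ⟨fun i => if i ∈ s then w i else 0, ?_, ?_, ∑ j ∈ s, ‖q j‖ ^ 2 * w j, fun i => ?_⟩
  · intro h
    have := congrFun h e
    simp [hes] at this
    exact hwe this
  · simpa using hw0
  · simp only [mul_ite, mul_zero, Finset.sum_ite_mem, Finset.univ_inter]
    have key : ∀ j, dist (q i) (q j) ^ 2 * w j
        = ‖q i‖ ^ 2 * w j - 2 * inner ℝ (q i) (w j • q j) + ‖q j‖ ^ 2 * w j := by
      intro j
      rw [dist_eq_norm, norm_sub_sq_real, inner_smul_right]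
      ring
    simp only [key, Finset.sum_add_distrib, Finset.sum_sub_distrib, ← Finset.mul_sum,
      ← inner_sum, hwq, inner_zero_right]
    have hw0' : ∑ i ∈ s, w i = 0 := hw0
    rw [hw0']
    ring

/-! ### Nearly regular tables of squared distances -/

/-- The quadratic form of a table of squared distances close to that of a regular simplex is
negative definite on vectors with coordinate sum zero: for an exactly regular table it is
`-2 ∑ yᵢ²` there. -/
lemma eq_zero_of_near_regular {ι : Type*} [Fintype ι] [DecidableEq ι] {W : ι → ι → ℝ} {y : ι → ℝ}
    {η : ℝ} (hη : η * Fintype.card ι < 2) (hη0 : 0 ≤ η)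
    (hW : ∀ i j, y i ≠ 0 → y j ≠ 0 → |W i j - if i = j then 0 else 2| ≤ η)
    (h0 : ∑ i, y i = 0) (hq : ∑ i, ∑ j, y i * W i j * y j = 0) : y = 0 := by
  have hsplit : ∑ i, ∑ j, y i * W i j * y j
      = ∑ i, ∑ j, y i * (W i j - if i = j then 0 else 2) * y j - 2 * ∑ i, y i ^ 2 := by
    have h2 : ∑ i, ∑ j, y i * y j = 0 := by
      rw [← Finset.sum_mul_sum, h0, zero_mul]
    have h3 : ∑ i, y i ^ 2 = ∑ i, ∑ j, if i = j then y i * y j else 0 := by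
      simp [sq]
    have h4 : ∑ i, ∑ j, y i * W i j * y j
        = ∑ i, ∑ j, y i * (W i j - if i = j then 0 else 2) * y j
          - 2 * ∑ i, y i ^ 2 + 2 * ∑ i, ∑ j, y i * y j := by
      rw [h3]
      simp only [Finset.mul_sum, ← Finset.sum_sub_distrib, ← Finset.sum_add_distrib]
      refine Finset.sum_congr rfl fun i _ => Finset.sum_congr rfl fun j _ => ?_
      split_ifs <;> ring
    rw [h4, h2]; ring
  have hb : ∑ i, ∑ j, y i * (W i j - if i = j then 0 else 2) * y j
      ≤ η * (Fintype.card ι * ∑ i, y i ^ 2) := by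
    calc ∑ i, ∑ j, y i * (W i j - if i = j then 0 else 2) * y j
        ≤ ∑ i, ∑ j, η * (|y i| * |y j|) := by
          refine Finset.sum_le_sum fun i _ => Finset.sum_le_sum fun j _ => ?_
          by_cases hi : y i = 0
          · simp [hi]
          by_cases hj : y j = 0
          · simp [hj]
          refine (le_abs_self _).trans ?_
          rw [abs_mul, abs_mul]
          have := mul_le_mul_of_nonneg_right (hW i j hi hj)
            (mul_nonneg (abs_nonneg (y i)) (abs_nonneg (y j)))
          linarith
      _ = η * (∑ i, |y i|) ^ 2 := by
          rw [sq, Finset.sum_mul_sum]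
          simp only [Finset.mul_sum]
      _ ≤ _ := by
          refine mul_le_mul_of_nonneg_left ?_ hη0
          have := sq_sum_le_card_mul_sum_sq (s := Finset.univ) (f := fun i => |y i|)
          simpa using this
  have hnn : 0 ≤ ∑ i, y i ^ 2 := Finset.sum_nonneg fun i _ => sq_nonneg _
  have hz : ∑ i, y i ^ 2 = 0 := by
    by_contra hne
    have hpos : 0 < ∑ i, y i ^ 2 := lt_of_le_of_ne hnn (Ne.symm hne)
    nlinarith
  rw [Finset.sum_eq_zero_iff_of_nonneg fun i _ => sq_nonneg _] at hz
  funext i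
  simpa using hz i (Finset.mem_univ i)

lemma det_cayleyMenger_regular_ne_zero {ι : Type*} [Fintype ι] [DecidableEq ι] [Nonempty ι]
    {W : ι → ι → ℝ} (h0 : ∀ i, W i i = 0) (h2 : ∀ i j, i ≠ j → W i j = 2) :
    (cayleyMenger W).det ≠ 0 := by
  rw [Ne, det_cayleyMenger_eq_zero_iff]
  rintro ⟨y, hy, hs, c, hc⟩
  refine hy (eq_zero_of_near_regular (W := W) (η := 0) (by simp) le_rfl ?_ hs ?_)
  · intro i j _ _
    by_cases hij : i = j
    · subst hij; simp [h0]
    · simp [hij, h2 i j hij]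
  · simp only [mul_assoc, ← Finset.mul_sum, hc, ← Finset.sum_mul, hs, zero_mul]

/-- If a nearly regular table with singular Cayley–Menger matrix has `W a b = 0`, then `a` and `b`
have the same entries, as for two coincident points. -/
lemma row_eq_of_det_cayleyMenger_eq_zero {ι : Type*} [Fintype ι] [DecidableEq ι] {W : ι → ι → ℝ}
    (hsymm : ∀ i j, W i j = W j i) (hdiag : ∀ i, W i i = 0) {a b : ι} (hab : a ≠ b)
    (hWab : W a b = 0) {η : ℝ} (hη : η * Fintype.card ι < 2) (hη0 : 0 ≤ η)
    (hW : ∀ i j, i ≠ j → s(i, j) ≠ s(a, b) → |W i j - 2| ≤ η)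
    (hdet : (cayleyMenger W).det = 0) (k : ι) : W a k = W b k := by
  have : Nonempty ι := ⟨a⟩
  rw [det_cayleyMenger_eq_zero_iff] at hdet
  obtain ⟨y, hy, hs, c, hc⟩ := hdet
  -- Moving the weight of `b` to `a` preserves the quadratic form, since `W a b = 0`.
  let δ : ι → ℝ := fun i => (if i = a then 1 else 0) - (if i = b then 1 else 0)
  let z : ι → ℝ := fun i => y i + y b * δ i
  have hδs : ∑ i, δ i = 0 := by simp [δ]
  have hδW : ∀ g : ι → ℝ, ∑ i, δ i * g i = g a - g b := by
    intro g; simp [δ, sub_mul]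
  have hWδ : ∀ i, ∑ j, W i j * δ j = W i a - W i b := by
    intro i; simpa [mul_comm] using hδW (W i)
  have hz : z = 0 := by
    refine eq_zero_of_near_regular (W := W) hη hη0 ?_ ?_ ?_
    · intro i j hi hj
      have hib : i ≠ b := by rintro rfl; exact hi (by simp [z, δ, hab.symm])
      have hjb : j ≠ b := by rintro rfl; exact hj (by simp [z, δ, hab.symm])
      by_cases hij : i = j
      · subst hij; simpa [hdiag] using hη0
      · rw [if_neg hij]
        refine hW i j hij ?_
        rw [Ne, Sym2.eq_iff]
        tauto
    · simp only [z, Finset.sum_add_distrib, ← Finset.mul_sum, hs, hδs]; simp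
    · have hrow : ∀ i, ∑ j, W i j * z j = c + y b * (W i a - W i b) := by
        intro i
        rw [← hc i, ← hWδ i, Finset.mul_sum, ← Finset.sum_add_distrib]
        exact Finset.sum_congr rfl fun j _ => by simp only [z]; ring
      have hzs : ∑ i, z i = 0 := by
        simp only [z, Finset.sum_add_distrib, ← Finset.mul_sum, hs, hδs]; simp
      have hyW : ∑ i, y i * (W i a - W i b) = 0 := by
        have e1 := hc a
        have e2 := hc b
        rw [← e2, ← sub_eq_zero, ← Finset.sum_sub_distrib] at e1
        rw [← e1]
        exact Finset.sum_congr rfl fun i _ => by rw [hsymm i a, hsymm i b]; ring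
      have hzW : ∑ i, z i * (W i a - W i b) = 0 := by
        have := hδW fun i => W i a - W i b
        simp only [z, add_mul, Finset.sum_add_distrib, hyW, mul_assoc, ← Finset.mul_sum, this]
        rw [hsymm b a, hWab, hdiag, hdiag]; ring
      calc ∑ i, ∑ j, z i * W i j * z j
          = ∑ i, (c * z i + y b * (z i * (W i a - W i b))) := by
            refine Finset.sum_congr rfl fun i _ => ?_
            simp only [mul_assoc, ← Finset.mul_sum, hrow]
            ring
        _ = 0 := by
            rw [Finset.sum_add_distrib, ← Finset.mul_sum, ← Finset.mul_sum, hzs, hzW]; simp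
  have hyδ : ∀ i, y i = -y b * δ i := by
    intro i
    have : y i + y b * δ i = 0 := congrFun hz i
    linarith
  have hyb : y b ≠ 0 := by
    intro h
    exact hy (funext fun i => by rw [hyδ, h]; simp)
  have hrow : ∀ i, -y b * (W i a - W i b) = c := by
    intro i
    rw [← hc i, ← hWδ i, Finset.mul_sum]
    exact Finset.sum_congr rfl fun j _ => by rw [hyδ j]; ring
  have hc0 : c = 0 := by
    rw [← hrow a, hdiag, hWab]; simp
  have := hrow k
  rw [hc0, mul_eq_zero] at this
  rcases this with h | h
  · exact absurd (neg_eq_zero.1 h) hyb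
  · rw [hsymm a k, hsymm b k]; linarith

/-! ### Graphs with few edges and large chromatic number -/

/-- A graph that is not `k`-colourable and has at most `(k + 1).choose 2` edges is a complete graph
on `k + 1` vertices: in a minimal non-colourable vertex set every vertex has at least `k`
neighbours, and counting edges leaves no room for anything else. -/
lemma exists_eq_complete_of_not_colorable {V : Type*} [Fintype V] [DecidableEq V]
    {F : Finset (Sym2 V)} {k : ℕ} (hk : 0 < k) (hdiag : ∀ e ∈ F, ¬ e.IsDiag)
    (hcard : F.card ≤ (k + 1).choose 2)
    (hcol : ¬ ∃ c : V → Fin k, ∀ a b, s(a, b) ∈ F → c a ≠ c b) :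
    ∃ U : Finset V, U.card = k + 1 ∧ F = U.offDiag.image (Function.uncurry Sym2.mk) := by
  classical
  let P : Finset V → Prop := fun U =>
    ¬ ∃ c : V → Fin k, ∀ a ∈ U, ∀ b ∈ U, s(a, b) ∈ F → c a ≠ c b
  have hP : P Finset.univ := by simpa [P] using hcol
  obtain ⟨U, -, hU, hmin⟩ := exists_minimal_le_of_wellFoundedLT P Finset.univ hP
  have hdeg : ∀ v ∈ U, k ≤ (U.filter fun w => s(v, w) ∈ F).card := by
    intro v hv
    by_contra hlt
    push Not at hlt
    have hc : ¬ P (U.erase v) := fun h =>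
      absurd (hmin h (Finset.erase_subset v U) hv) (Finset.notMem_erase v U)
    simp only [P, not_not] at hc
    obtain ⟨c, hc⟩ := hc
    obtain ⟨x, hx⟩ : ∃ x : Fin k, x ∉ (U.filter fun w => s(v, w) ∈ F).image c := by
      by_contra hall
      push Not at hall
      have := Finset.card_le_card (fun x _ => hall x : (Finset.univ : Finset (Fin k)) ⊆ _)
      rw [Finset.card_univ, Fintype.card_fin] at this
      exact absurd (this.trans Finset.card_image_le) (not_le.2 hlt)
    have hx' : ∀ w ∈ U, s(v, w) ∈ F → c w ≠ x := fun w hw hvw h =>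
      hx (Finset.mem_image.2 ⟨w, Finset.mem_filter.2 ⟨hw, hvw⟩, h⟩)
    refine hU ⟨Function.update c v x, fun a ha b hb hab => ?_⟩
    by_cases hav : a = v
    · by_cases hbv : b = v
      · exact absurd (by simp [hav, hbv]) (hdiag _ hab)
      · subst hav
        rw [Function.update_self, Function.update_of_ne hbv]
        exact (hx' b hb hab).symm
    · by_cases hbv : b = v
      · subst hbv
        rw [Function.update_self, Function.update_of_ne hav]
        exact hx' a ha (by rwa [Sym2.eq_swap])
      · rw [Function.update_of_ne hav, Function.update_of_ne hbv]
        exact hc a (Finset.mem_erase.2 ⟨hav, ha⟩) b (Finset.mem_erase.2 ⟨hbv, hb⟩) hab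
  obtain ⟨v, hv⟩ : U.Nonempty := by
    rw [Finset.nonempty_iff_ne_empty]
    rintro rfl
    exact hU ⟨fun _ => ⟨0, hk⟩, by simp⟩
  have hnb : ∀ v ∈ U, (U.filter fun w => s(v, w) ∈ F) ⊆ U.erase v := by
    intro v hv w hw
    rw [Finset.mem_filter] at hw
    refine Finset.mem_erase.2 ⟨?_, hw.1⟩
    rintro rfl
    exact hdiag _ hw.2 (by simp)
  have hcardU : k + 1 ≤ U.card := by
    have := (hdeg v hv).trans (Finset.card_le_card (hnb v hv))
    rw [Finset.card_erase_of_mem hv] at this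
    have := Finset.card_pos.2 ⟨v, hv⟩
    omega
  have hsum : U.card * k ≤ 2 * F.card := by
    let Γ : SimpleGraph V := SimpleGraph.fromEdgeSet (F : Set (Sym2 V))
    have hE : ∑ v, Γ.degree v = 2 * F.card := by
      rw [Γ.sum_degrees_eq_twice_card_edges]
      congr 2
      ext e
      simp only [Γ, SimpleGraph.mem_edgeFinset, SimpleGraph.edgeSet_fromEdgeSet, Set.mem_sdiff,
        Finset.mem_coe]
      exact ⟨fun h => h.1, fun h => ⟨h, by simpa using hdiag e h⟩⟩
    rw [← hE]
    calc U.card * k ≤ ∑ v ∈ U, Γ.degree v := by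
          rw [← smul_eq_mul]
          refine Finset.card_nsmul_le_sum _ _ _ fun v hv => (hdeg v hv).trans ?_
          refine Finset.card_le_card fun w hw => ?_
          rw [Finset.mem_filter] at hw
          rw [SimpleGraph.mem_neighborFinset, SimpleGraph.fromEdgeSet_adj]
          refine ⟨hw.2, ?_⟩
          rintro rfl
          exact hdiag _ hw.2 (by simp)
      _ ≤ _ := Finset.sum_le_sum_of_subset (Finset.subset_univ U)
  have hchoose : 2 * (k + 1).choose 2 = (k + 1) * k := by
    have := Nat.div_mul_cancel (Nat.even_mul_pred_self (k + 1)).two_dvd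
    rw [Nat.choose_two_right]
    simpa [mul_comm] using this
  have hUk : U.card = k + 1 := by
    refine le_antisymm ?_ hcardU
    have : U.card * k ≤ (k + 1) * k := by omega
    exact Nat.le_of_mul_le_mul_right this hk
  refine ⟨U, hUk, (Finset.eq_of_subset_of_card_le ?_ ?_).symm⟩
  · intro e he
    rw [Finset.mem_image] at he
    obtain ⟨⟨a, b⟩, hab, rfl⟩ := he
    rw [Finset.mem_offDiag] at hab
    obtain ⟨ha, hb, hne⟩ := hab
    have heq := Finset.eq_of_subset_of_card_le (hnb a ha) (by
      rw [Finset.card_erase_of_mem ha, hUk]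
      exact hdeg a ha)
    have : b ∈ U.filter fun w => s(a, w) ∈ F := by
      rw [heq]; exact Finset.mem_erase.2 ⟨hne.symm, hb⟩
    exact (Finset.mem_filter.1 this).2
  · rw [Sym2.card_image_offDiag, hUk]
    exact hcard

/-! ### Edge maps induced by vertex maps -/

/-- An injective map between the edges of complete graphs that takes triangles to triangles comes
from a map of the vertices. -/
lemma exists_vertex_map {ι V : Type*} [Fintype ι] (hι : 3 ≤ Fintype.card ι) {f : Sym2 ι → Sym2 V}
    (hinj : ∀ e e', ¬ e.IsDiag → ¬ e'.IsDiag → f e = f e' → e = e')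
    (htri : ∀ i j k, i ≠ j → i ≠ k → j ≠ k → ∃ a b c, a ≠ b ∧ a ≠ c ∧ b ≠ c ∧
      f s(i, j) = s(a, b) ∧ f s(i, k) = s(a, c) ∧ f s(j, k) = s(b, c)) :
    ∃ ψ : ι → V, ∀ i j, i ≠ j → f s(i, j) = s(ψ i, ψ j) := by
  classical
  have hthird : ∀ i j : ι, ∃ k, k ≠ i ∧ k ≠ j := by
    intro i j
    have : (({i, j} : Finset ι)).card < (Finset.univ : Finset ι).card :=
      (Finset.card_le_two).trans_lt (by rw [Finset.card_univ]; omega)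
    obtain ⟨k, -, hk⟩ := Finset.exists_mem_notMem_of_card_lt_card this
    simp only [Finset.mem_insert, Finset.mem_singleton, not_or] at hk
    exact ⟨k, hk⟩
  have hstar : ∀ i, ∃ a, ∀ l, l ≠ i → a ∈ f s(i, l) := by
    intro i
    obtain ⟨j, hji, -⟩ := hthird i i
    obtain ⟨k, hki, hkj⟩ := hthird i j
    obtain ⟨a, b, c, hab, hac, hbc, h1, h2, h3⟩ := htri i j k hji.symm hki.symm hkj.symm
    refine ⟨a, fun l hl => ?_⟩
    by_cases hlj : l = j
    · subst hlj; rw [h1]; simp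
    by_cases hlk : l = k
    · subst hlk; rw [h2]; simp
    obtain ⟨a', b', c', -, -, -, g1, g2, -⟩ := htri i j l hji.symm hl.symm (Ne.symm hlj)
    obtain ⟨a'', b'', c'', -, -, -, g1', g2', -⟩ := htri i k l hki.symm hl.symm (Ne.symm hlk)
    -- An edge meeting `ab` and `ac` but avoiding `a` is `bc`, the image of `jk`.
    by_contra hmem
    have hb : b ∈ f s(i, l) := by
      have h5 : a' ∈ s(a, b) := by rw [← h1, g1]; simp
      have h6 : a' ∈ f s(i, l) := by rw [g2]; simp
      rcases Sym2.mem_iff.1 h5 with rfl | rfl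
      · exact absurd h6 hmem
      · exact h6
    have hc : c ∈ f s(i, l) := by
      have h5 : a'' ∈ s(a, c) := by rw [← h2, g1']; simp
      have h6 : a'' ∈ f s(i, l) := by rw [g2']; simp
      rcases Sym2.mem_iff.1 h5 with rfl | rfl
      · exact absurd h6 hmem
      · exact h6
    have h7 : f s(i, l) = f s(j, k) := by
      rw [h3]; exact (Sym2.mem_and_mem_iff hbc).1 ⟨hb, hc⟩
    have h8 := hinj _ _ (by simpa using hl.symm) (by simpa using hkj.symm) h7
    rw [Sym2.eq_iff] at h8
    rcases h8 with ⟨h, -⟩ | ⟨h, -⟩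
    · exact hji h.symm
    · exact hki h.symm
  choose ψ hψ using hstar
  refine ⟨ψ, fun i j hij => ?_⟩
  have hi : ψ i ∈ f s(i, j) := hψ i j hij.symm
  have hj : ψ j ∈ f s(i, j) := by rw [Sym2.eq_swap]; exact hψ j i hij
  have hne : ψ i ≠ ψ j := by
    intro heq
    obtain ⟨k, hki, hkj⟩ := hthird i j
    obtain ⟨a, b, c, hab, hac, hbc, h1, h2, h3⟩ := htri i j k hij hki.symm hkj.symm
    have hk1 := hψ i k hki
    have hk2 := hψ j k hkj
    rw [h1] at hi
    rw [h2] at hk1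
    rw [h3, ← heq] at hk2
    rw [Sym2.mem_iff] at hi hk1 hk2
    grind
  exact (Sym2.mem_and_mem_iff hne).1 ⟨hi, hj⟩

/-! ### Squared distances of generic configurations -/

/-- The squared distance between the two endpoints of an unordered pair of indices. Unlike
`sqLength` it is defined for diagonal pairs too, where it is `0`. -/
noncomputable def sqDist {ι : Type*} {d : ℕ} (x : ι → EuclideanSpace ℝ (Fin d)) (e : Sym2 ι) : ℝ :=
  Sym2.lift ⟨fun i j => dist (x i) (x j) ^ 2, fun i j => by simp only [dist_comm]⟩ e

lemma sqDist_mk {ι : Type*} {d : ℕ} (x : ι → EuclideanSpace ℝ (Fin d)) (i j : ι) :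
    sqDist x s(i, j) = dist (x i) (x j) ^ 2 := rfl

lemma sqDist_of_isDiag {ι : Type*} {d : ℕ} (x : ι → EuclideanSpace ℝ (Fin d)) {e : Sym2 ι}
    (he : e.IsDiag) : sqDist x e = 0 := by
  induction e with
  | _ i j => rw [Sym2.mk_isDiag_iff] at he; simp [sqDist_mk, he]

lemma sqDist_comp {ι κ : Type*} {d : ℕ} (x : ι → EuclideanSpace ℝ (Fin d)) (c : κ → ι)
    (e : Sym2 κ) : sqDist (x ∘ c) e = sqDist x (e.map c) := by
  induction e with
  | _ i j => rfl

/-- The squared distance as a polynomial in the coordinates of the configuration. -/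
noncomputable def sqDistPoly {n : ℕ} (d : ℕ) (e : Sym2 (Fin n)) :
    MvPolynomial (Fin n × Fin d) ℚ :=
  Sym2.lift ⟨fun i j => ∑ a, (MvPolynomial.X (i, a) - MvPolynomial.X (j, a)) ^ 2,
    fun i j => Finset.sum_congr rfl fun a _ => by ring⟩ e

lemma aeval_sqDistPoly {d n : ℕ} (x : Configuration d n) (e : Sym2 (Fin n)) :
    MvPolynomial.aeval (fun i : Fin n × Fin d => x i.1 i.2) (sqDistPoly d e) = sqDist x e := by
  induction e with
  | _ i j =>
    simp only [sqDistPoly, Sym2.lift_mk, map_sum, map_pow, map_sub, MvPolynomial.aeval_X,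
      sqDist_mk, EuclideanSpace.dist_sq_eq, Real.dist_eq, sq_abs]

/-- A polynomial relation over `ℚ` at a generic configuration holds at every configuration. -/
lemma IsGeneric.aeval_eq_zero {d n : ℕ} {p : Configuration d n} (hp : IsGeneric p)
    {P : MvPolynomial (Fin n × Fin d) ℚ}
    (h : MvPolynomial.aeval (fun i : Fin n × Fin d => p i.1 i.2) P = 0) (x : Configuration d n) :
    MvPolynomial.aeval (fun i : Fin n × Fin d => x i.1 i.2) P = 0 := by
  rw [algebraicIndependent_iff.1 hp P h, map_zero]

lemma IsGeneric.det_cayleyMenger_eq_zero {d n : ℕ} {p : Configuration d n} (hp : IsGeneric p)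
    {ι : Type*} [Fintype ι] [DecidableEq ι] {f : Sym2 ι → Sym2 (Fin n)}
    (h : (cayleyMenger fun i j => sqDist p (f s(i, j))).det = 0) (x : Configuration d n) :
    (cayleyMenger fun i j => sqDist x (f s(i, j))).det = 0 := by
  have key : ∀ x : Configuration d n,
      MvPolynomial.aeval (fun i : Fin n × Fin d => x i.1 i.2)
        (cayleyMenger fun i j => sqDistPoly d (f s(i, j))).det
      = (cayleyMenger fun i j => sqDist x (f s(i, j))).det := by
    intro x
    rw [AlgHom.map_det]
    congr 1
    ext (i | i) (j | j) <;>
      simp [cayleyMenger, aeval_sqDistPoly]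
  rw [← key] at h ⊢
  exact hp.aeval_eq_zero h x

/-- In a generic configuration distinct edges have distinct lengths. -/
lemma IsGeneric.sqDist_injective {d n : ℕ} (hd : 0 < d) {p : Configuration d n} (hp : IsGeneric p)
    {e e' : Sym2 (Fin n)} (he : ¬ e.IsDiag) (he' : ¬ e'.IsDiag) (h : sqDist p e = sqDist p e') :
    e = e' := by
  by_contra hne
  obtain ⟨v, hv, hv'⟩ : ∃ v ∈ e, v ∉ e' := by
    induction e with
    | _ a b =>
      rw [Sym2.mk_isDiag_iff] at he
      by_contra hall
      push Not at hall
      exact hne ((Sym2.mem_and_mem_iff he).1 ⟨hall a (by simp), hall b (by simp)⟩).symm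
  -- Evaluate at the configuration that moves only the vertex `v` away from the origin.
  let x : Configuration d n := fun w => if w = v then EuclideanSpace.single ⟨0, hd⟩ 1 else 0
  have hx := hp.aeval_eq_zero (P := sqDistPoly d e - sqDistPoly d e')
    (by rw [map_sub, aeval_sqDistPoly, aeval_sqDistPoly, h, sub_self]) x
  rw [map_sub, aeval_sqDistPoly, aeval_sqDistPoly] at hx
  have h1 : sqDist x e = 1 := by
    obtain ⟨u, rfl⟩ := hv
    rw [Sym2.mk_isDiag_iff] at he
    simp [sqDist_mk, x, Ne.symm he]
  have h0 : sqDist x e' = 0 := by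
    induction e' with
    | _ a b =>
      simp only [Sym2.mem_iff, not_or] at hv'
      simp [sqDist_mk, x, Ne.symm hv'.1, Ne.symm hv'.2]
  rw [h1, h0] at hx
  norm_num at hx

/-! ### Regular simplices -/

lemma exists_regular_simplex {d : ℕ} (hd : 0 < d) :
    ∃ Δ : Fin (d + 1) → EuclideanSpace ℝ (Fin d), ∀ i j, i ≠ j → dist (Δ i) (Δ j) ^ 2 = 2 := by
  -- The vertex `0` is `(c, …, c)`, the others are the unit vectors, and `d c² - 2 c + 1 = 2`.
  have hd' : (0 : ℝ) < d := by exact_mod_cast hd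
  let c : ℝ := (1 + √(d + 1)) / d
  have hc : d * c ^ 2 - 2 * c + 1 = 2 := by
    have : √((d : ℝ) + 1) ^ 2 = d + 1 := Real.sq_sqrt (by positivity)
    simp only [c]
    field_simp
    linarith
  have h0 : ∀ i : Fin d,
      dist (WithLp.toLp 2 fun _ => c : EuclideanSpace ℝ (Fin d)) (EuclideanSpace.single i 1) ^ 2
        = 2 := by
    intro i
    rw [dist_eq_norm, norm_sub_sq_real, EuclideanSpace.inner_single_right,
      EuclideanSpace.real_norm_sq_eq]
    simp
    linarith
  refine ⟨Fin.cases (WithLp.toLp 2 fun _ => c) fun i => EuclideanSpace.single i 1, fun i j => ?_⟩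
  refine Fin.cases ?_ (fun i => ?_) i <;> refine Fin.cases ?_ (fun j => ?_) j
  · simp
  · intro _; exact h0 j
  · intro _; rw [dist_comm]; exact h0 i
  · intro hij
    have hij' : i ≠ j := fun h => hij (by rw [h])
    simp only [Fin.cases_succ]
    rw [dist_eq_norm, norm_sub_sq_real, EuclideanSpace.inner_single_right]
    simp [hij'.symm]
    norm_num

/-- Given two distinct edges, moving an endpoint of one that is not on the other along the first
edge makes their lengths differ. -/
lemma exists_near_regular_simplex {d : ℕ} (hd : 0 < d) {e e' : Sym2 (Fin (d + 1))}
    (he : ¬ e.IsDiag) (he' : ¬ e'.IsDiag) (hne : e ≠ e') {η : ℝ} (hη : 0 < η) :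
    ∃ Δ : Fin (d + 1) → EuclideanSpace ℝ (Fin d),
      (∀ i j, i ≠ j → |dist (Δ i) (Δ j) ^ 2 - 2| ≤ η) ∧ sqDist Δ e ≠ sqDist Δ e' := by
  obtain ⟨Δ, hΔ⟩ := exists_regular_simplex hd
  obtain ⟨v, hv, hv'⟩ : ∃ v ∈ e, v ∉ e' := by
    induction e with
    | _ a b =>
      rw [Sym2.mk_isDiag_iff] at he
      by_contra hall
      push Not at hall
      exact hne ((Sym2.mem_and_mem_iff he).1 ⟨hall a (by simp), hall b (by simp)⟩).symm
  obtain ⟨u, rfl⟩ := hv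
  rw [Sym2.mk_isDiag_iff] at he
  obtain ⟨s, hs0, hs1, hsη⟩ : ∃ s : ℝ, 0 < s ∧ s ≤ 1 ∧ 6 * s ≤ η :=
    ⟨min 1 (η / 6), by positivity, min_le_left _ _, by linarith [min_le_right 1 (η / 6)]⟩
  let x : EuclideanSpace ℝ (Fin d) := Δ v + s • (Δ v - Δ u)
  have hnorm : ∀ i j, i ≠ j → ‖Δ i - Δ j‖ ^ 2 = 2 := by
    intro i j hij; rw [← dist_eq_norm, hΔ i j hij]
  have hx : ∀ w, w ≠ v → dist x (Δ w) ^ 2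
      = 2 + 2 * s * inner ℝ (Δ v - Δ w) (Δ v - Δ u) + 2 * s ^ 2 := by
    intro w hw
    have : x - Δ w = (Δ v - Δ w) + s • (Δ v - Δ u) := by simp only [x]; abel
    rw [dist_eq_norm, this, norm_add_sq_real, inner_smul_right, norm_smul, mul_pow,
      hnorm v w hw.symm, hnorm v u he, Real.norm_eq_abs, sq_abs]
    ring
  have hin : ∀ w, w ≠ v → |inner ℝ (Δ v - Δ w) (Δ v - Δ u)| ≤ 2 := by
    intro w hw
    have h1 := abs_real_inner_le_norm (Δ v - Δ w) (Δ v - Δ u)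
    nlinarith [hnorm v w hw.symm, hnorm v u he, sq_nonneg (‖Δ v - Δ w‖ - ‖Δ v - Δ u‖)]
  have hbound : ∀ w, w ≠ v → |dist x (Δ w) ^ 2 - 2| ≤ η := by
    intro w hw
    rw [hx w hw]
    have h2 := abs_le.1 (hin w hw)
    rw [abs_le]
    constructor <;> nlinarith
  refine ⟨Function.update Δ v x, fun i j hij => ?_, ?_⟩
  · by_cases hi : i = v
    · subst hi
      rw [Function.update_self, Function.update_of_ne hij.symm]
      exact hbound j hij.symm
    · by_cases hj : j = v
      · subst hj
        rw [Function.update_self, Function.update_of_ne hij, dist_comm]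
        exact hbound i hij
      · rw [Function.update_of_ne hi, Function.update_of_ne hj, hΔ i j hij]
        simpa using hη.le
  · have h1 : sqDist (Function.update Δ v x) s(v, u) = 2 + 4 * s + 2 * s ^ 2 := by
      rw [sqDist_mk, Function.update_self, Function.update_of_ne (Ne.symm he), hx u (Ne.symm he),
        real_inner_self_eq_norm_sq, hnorm v u he]
      ring
    have h2 : sqDist (Function.update Δ v x) e' = 2 := by
      induction e' with
      | _ a b =>
        simp only [Sym2.mem_iff, not_or] at hv'
        rw [Sym2.mk_isDiag_iff] at he'
        rw [sqDist_mk, Function.update_of_ne (Ne.symm hv'.1), Function.update_of_ne (Ne.symm hv'.2),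
          hΔ a b he']
    rw [h1, h2]
    nlinarith

/-- At most `d + 1` points of a generic configuration are affinely independent, because the vertices
of a regular simplex are. -/
lemma IsGeneric.affineIndependent {d n : ℕ} (hd : 0 < d) {p : Configuration d n} (hp : IsGeneric p)
    {κ : Type*} [Fintype κ] (hκ : Fintype.card κ ≤ d + 1) {ψ : κ → Fin n}
    (hψ : Function.Injective ψ) : AffineIndependent ℝ (p ∘ ψ) := by
  classical
  rcases isEmpty_or_nonempty κ with hκe | hκe
  · exact affineIndependent_of_subsingleton ℝ _
  by_contra h
  have h1 := det_cayleyMenger_of_not_affineIndependent h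
  obtain ⟨Δ, hΔ⟩ := exists_regular_simplex hd
  obtain ⟨g⟩ : Nonempty (κ ↪ Fin (d + 1)) :=
    Function.Embedding.nonempty_of_card_le (by simpa using hκ)
  let c : Fin n → Fin (d + 1) := Function.extend ψ g fun _ => 0
  have hc : ∀ i, c (ψ i) = g i := fun i => hψ.extend_apply _ _ i
  have h2 := hp.det_cayleyMenger_eq_zero (f := Sym2.map ψ) h1 (Δ ∘ c)
  refine det_cayleyMenger_regular_ne_zero ?_ ?_ h2
  · intro i; simp [sqDist_mk]
  · intro i j hij
    simp only [Sym2.map_mk, sqDist_mk, Function.comp, hc]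
    exact hΔ _ _ fun h => hij (g.injective h)

/-! ### Generic points carrying the lengths of a simplex -/

/-- If the lengths in a generic configuration of `(d + 2).choose 2` edges, repetitions allowed, make
the Cayley–Menger determinant on `d + 2` vertices vanish, then the edges are distinct and form a
complete graph: otherwise the graph of these edges is `(d + 1)`-colourable, and a configuration that
puts the colours at the vertices of a regular simplex gives all edges the same length. -/
lemma IsGeneric.injOn_and_complete {d n : ℕ} (hd : 0 < d) {p : Configuration d n}
    (hp : IsGeneric p) {ι : Type*} [Fintype ι] [DecidableEq ι] (hι : Fintype.card ι = d + 2)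
    {f : Sym2 ι → Sym2 (Fin n)} (hf : ∀ e, (f e).IsDiag ↔ e.IsDiag)
    (hdet : (cayleyMenger fun i j => sqDist p (f s(i, j))).det = 0) :
    (∀ e e', ¬ e.IsDiag → ¬ e'.IsDiag → f e = f e' → e = e') ∧
    ∃ U : Finset (Fin n), U.card = d + 2 ∧ ∀ e, ¬ e.IsDiag → ∀ v ∈ f e, v ∈ U := by
  have : Nonempty ι := Fintype.card_pos_iff.1 (by omega)
  let K : Finset (Sym2 ι) := Finset.univ.offDiag.image (Function.uncurry Sym2.mk)
  have hK : ∀ e, e ∈ K ↔ ¬ e.IsDiag := by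
    intro e
    induction e with
    | _ i j =>
      rw [Sym2.mk_isDiag_iff]
      simp only [K, Finset.mem_image, Finset.mem_offDiag, Finset.mem_univ, true_and]
      constructor
      · rintro ⟨⟨a, b⟩, hab, h⟩ rfl
        have hdiag : s(a, b).IsDiag := by rw [show s(a, b) = s(i, i) from h]; simp
        exact hab (Sym2.mk_isDiag_iff.1 hdiag)
      · exact fun h => ⟨(i, j), h, rfl⟩
  have hKcard : K.card = (d + 2).choose 2 := by
    rw [Sym2.card_image_offDiag, Finset.card_univ, hι]
  obtain ⟨U, hU, hFU⟩ := exists_eq_complete_of_not_colorable (F := K.image f) (k := d + 1)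
    (Nat.succ_pos d)
    (by
      intro e he
      obtain ⟨e, he, rfl⟩ := Finset.mem_image.1 he
      rwa [hf, ← hK])
    (Finset.card_image_le.trans hKcard.le)
    (by
      rintro ⟨c, hc⟩
      obtain ⟨Δ, hΔ⟩ := exists_regular_simplex hd
      refine det_cayleyMenger_regular_ne_zero ?_ ?_ (hp.det_cayleyMenger_eq_zero hdet (Δ ∘ c))
      · intro i
        exact sqDist_of_isDiag _ ((hf _).2 (by simp))
      · intro i j hij
        have hmem : f s(i, j) ∈ K.image f :=
          Finset.mem_image_of_mem f ((hK _).2 (by simpa using hij))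
        generalize f s(i, j) = e at hmem
        induction e with
        | _ a b => exact hΔ _ _ (hc a b hmem))
  constructor
  · have hinj : Set.InjOn f K := by
      rw [← Finset.card_image_iff, hKcard, hFU, Sym2.card_image_offDiag, hU]
    exact fun e e' he he' h => hinj ((hK e).2 he) ((hK e').2 he') h
  · refine ⟨U, hU, fun e he v hv => ?_⟩
    have hmem : f e ∈ K.image f := Finset.mem_image_of_mem f ((hK _).2 he)
    rw [hFU] at hmem
    obtain ⟨⟨a, b⟩, hab, h⟩ := Finset.mem_image.1 hmem
    rw [Finset.mem_offDiag] at hab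
    rw [← h] at hv
    rcases Sym2.mem_iff.1 hv with rfl | rfl
    · exact hab.1
    · exact hab.2.1

/-- An edge map `f` under which the lengths of a generic configuration satisfy the Cayley–Menger
relation on `d + 2` vertices takes triangles to triangles: put the endpoints `a`, `b` of the image
of `ij` at one point and the remaining vertices near a regular simplex with two given lengths
distinct. Then `ik` and `jk` get the same length, so their images become equal when `a` and `b` are
identified. -/
lemma IsGeneric.exists_triangle {d n : ℕ} (hd : 0 < d) {p : Configuration d n}
    (hp : IsGeneric p) {ι : Type*} [Fintype ι] [DecidableEq ι] (hι : Fintype.card ι = d + 2)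
    {f : Sym2 ι → Sym2 (Fin n)} (hf : ∀ e, (f e).IsDiag ↔ e.IsDiag)
    (hdet : (cayleyMenger fun i j => sqDist p (f s(i, j))).det = 0) {i j k : ι} (hij : i ≠ j)
    (hik : i ≠ k) (hjk : j ≠ k) :
    ∃ a b c, a ≠ b ∧ a ≠ c ∧ b ≠ c ∧
      f s(i, j) = s(a, b) ∧ f s(i, k) = s(a, c) ∧ f s(j, k) = s(b, c) := by
  obtain ⟨hinj, U, hU, hmemU⟩ := hp.injOn_and_complete hd hι hf hdet
  have hndiag : ∀ {i j : ι}, i ≠ j → ¬ (f s(i, j)).IsDiag := fun h => by simpa [hf] using h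
  obtain ⟨a, b, hab⟩ : ∃ a b, f s(i, j) = s(a, b) := by
    induction f s(i, j) with
    | _ a b => exact ⟨a, b, rfl⟩
  have hne : a ≠ b := by simpa [hab] using hndiag hij
  have haU : a ∈ U := hmemU s(i, j) (by simpa using hij) a (by simp [hab])
  have hbU : b ∈ U := hmemU s(i, j) (by simpa using hij) b (by simp [hab])
  -- The map `c` places the vertices on a simplex, sending only `a` and `b` to the same vertex.
  obtain ⟨c, hcab, hc⟩ : ∃ c : Fin n → Fin (d + 1), c a = c b ∧
      ∀ v ∈ U, ∀ w ∈ U, c v = c w → v = w ∨ s(v, w) = s(a, b) := by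
    have hcard : (U.erase b).card = d + 1 := by rw [Finset.card_erase_of_mem hbU, hU]; rfl
    let g := (U.erase b).equivFinOfCardEq hcard
    let r : Fin n → Fin n := fun v => if v = b then a else v
    have hr : ∀ v ∈ U, r v ∈ U.erase b := by
      intro v hv
      simp only [r]
      split_ifs with h
      · exact Finset.mem_erase.2 ⟨hne, haU⟩
      · exact Finset.mem_erase.2 ⟨h, hv⟩
    refine ⟨fun v => if h : r v ∈ U.erase b then g ⟨r v, h⟩ else 0, ?_, fun v hv w hw h => ?_⟩
    · have : r a = r b := by simp [r]
      simp only [this]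
    · simp only [hr v hv, hr w hw, dif_pos] at h
      have h' : r v = r w := congrArg Subtype.val (g.injective h)
      rw [Sym2.eq_iff]
      simp only [r] at h'
      grind
  have hcdiag : ∀ e : Sym2 ι, ¬ e.IsDiag → f e ≠ s(a, b) → ¬ ((f e).map c).IsDiag := by
    intro e he heab hdiag
    have h1 := hmemU e he
    have h2 := (hf e).not.2 he
    generalize f e = t at *
    induction t with
    | _ v w =>
      rw [Sym2.map_mk, Sym2.mk_isDiag_iff] at hdiag
      rcases hc v (h1 v (by simp)) w (h1 w (by simp)) hdiag with h | h
      · exact h2 (by simpa using h)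
      · exact heab h
  have hne_ab : ∀ {u v : ι}, u ≠ v → s(u, v) ≠ s(i, j) → f s(u, v) ≠ s(a, b) := by
    intro u v huv h h'
    exact h (hinj _ _ (by simpa using huv) (by simpa using hij) (h'.trans hab.symm))
  have hik_ij : s(i, k) ≠ s(i, j) := by rw [Ne, Sym2.eq_iff]; grind
  have hjk_ij : s(j, k) ≠ s(i, j) := by rw [Ne, Sym2.eq_iff]; grind
  have hik_jk : s(i, k) ≠ s(j, k) := by rw [Ne, Sym2.eq_iff]; grind
  have hmap : (f s(i, k)).map c = (f s(j, k)).map c := by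
    by_contra hmap
    let η : ℝ := 1 / Fintype.card ι
    have hcardpos : (0 : ℝ) < Fintype.card ι := by rw [hι]; positivity
    obtain ⟨Δ, hΔ, hlen⟩ := exists_near_regular_simplex hd
      (hcdiag s(i, k) (by simpa using hik) (hne_ab hik hik_ij))
      (hcdiag s(j, k) (by simpa using hjk) (hne_ab hjk hjk_ij)) hmap (η := η) (by positivity)
    rw [← sqDist_comp, ← sqDist_comp] at hlen
    refine hlen (row_eq_of_det_cayleyMenger_eq_zero (η := η)
      (W := fun u v => sqDist (Δ ∘ c) (f s(u, v))) ?_ ?_ hij ?_ ?_ (by positivity) ?_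
      (hp.det_cayleyMenger_eq_zero hdet _) k)
    · intro u v; simp only [Sym2.eq_swap]
    · intro u; exact sqDist_of_isDiag _ ((hf _).2 (by simp))
    · simp [hab, sqDist_mk, hcab]
    · rw [one_div_mul_cancel hcardpos.ne']; norm_num
    · intro u v huv huv'
      have h1 := hcdiag s(u, v) (by simpa using huv) (hne_ab huv huv')
      simp only [sqDist_comp]
      generalize (f s(u, v)).map c = t at h1
      induction t with
      | _ x y => exact hΔ x y (by simpa using h1)
  have hfne : f s(i, k) ≠ f s(j, k) := fun h =>
    hik_jk (hinj _ _ (by simpa using hik) (by simpa using hjk) h)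
  have h1 := hne_ab hik hik_ij
  have h2 := hne_ab hjk hjk_ij
  have h3 := hndiag hik
  have h4 := hndiag hjk
  have h5 := hmemU s(i, k) (by simpa using hik)
  have h6 := hmemU s(j, k) (by simpa using hjk)
  -- Two edges that agree after identifying `a` with `b` differ only in these endpoints.
  have hfinal : ∀ v w v' w', f s(i, k) = s(v, w) → f s(j, k) = s(v', w') → c v = c v' →
      c w = c w' → ∃ a b c, a ≠ b ∧ a ≠ c ∧ b ≠ c ∧
        f s(i, j) = s(a, b) ∧ f s(i, k) = s(a, c) ∧ f s(j, k) = s(b, c) := by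
    intro v w v' w' e1 e2 hv hw
    rw [e1] at h1 h3 h5 hfne
    rw [e2] at h2 h4 h6 hfne
    rw [Sym2.mk_isDiag_iff] at h3 h4
    have k1 := hc v (h5 v (by simp)) v' (h6 v' (by simp)) hv
    have k2 := hc w (h5 w (by simp)) w' (h6 w' (by simp)) hw
    rw [e1, e2, hab]
    simp only [Ne, Sym2.eq_iff, not_or, not_and] at h1 h2 hfne k1 k2
    rcases k1 with rfl | k1
    · rcases k2 with rfl | k2
      · exact absurd rfl (hfne.1 rfl)
      · exact ⟨w, w', v, by grind, by grind, by grind, by rw [Sym2.eq_iff]; grind,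
          Sym2.eq_swap, Sym2.eq_swap⟩
    · rcases k2 with rfl | k2
      · exact ⟨v, v', w, by grind, by grind, by grind, by rw [Sym2.eq_iff]; grind, rfl, rfl⟩
      · exfalso; grind
  clear h1 h2 h3 h4 h5 h6 hfne
  obtain ⟨v, w, e1⟩ : ∃ v w, f s(i, k) = s(v, w) := by
    induction f s(i, k) with
    | _ a b => exact ⟨a, b, rfl⟩
  obtain ⟨v', w', e2⟩ : ∃ v w, f s(j, k) = s(v, w) := by
    induction f s(j, k) with
    | _ a b => exact ⟨a, b, rfl⟩
  rw [e1, e2, Sym2.map_mk, Sym2.map_mk, Sym2.eq_iff] at hmap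
  rcases hmap with ⟨hv, hw⟩ | ⟨hv, hw⟩
  · exact hfinal v w v' w' e1 e2 hv hw
  · exact hfinal v w w' v' e1 (e2.trans Sym2.eq_swap) hv hw

/-- If all pairwise distances of `d + 2` points of `d`-space occur in a generic
configuration, then the points are congruent to points of that configuration. -/
lemma IsGeneric.exists_labels {d n : ℕ} (hd : 0 < d) {p : Configuration d n} (hp : IsGeneric p)
    {ι : Type*} [Fintype ι] (hι : Fintype.card ι = d + 2) (q : ι → EuclideanSpace ℝ (Fin d))
    (h : ∀ i j, i ≠ j → ∃ e : Edge n, sqLength p e = dist (q i) (q j) ^ 2) :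
    ∃ ψ : ι → Fin n, ∀ i j, dist (q i) (q j) = dist (p (ψ i)) (p (ψ j)) := by
  classical
  have : Nonempty ι := Fintype.card_pos_iff.1 (by omega)
  have hf : ∀ e : Sym2 ι, ∃ e' : Sym2 (Fin n), (e'.IsDiag ↔ e.IsDiag) ∧
      sqDist p e' = sqDist q e := by
    obtain ⟨i, j, hij⟩ : ∃ i j : ι, i ≠ j :=
      Fintype.exists_pair_of_one_lt_card (by omega)
    obtain ⟨⟨e₀, -⟩, -⟩ := h i j hij
    obtain ⟨v⟩ : Nonempty (Fin n) := by
      induction e₀ with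
      | _ v w => exact ⟨v⟩
    intro e
    induction e with
    | _ i j =>
      by_cases hij : i = j
      · subst hij
        exact ⟨s(v, v), by simp, by simp [sqDist_mk]⟩
      · obtain ⟨e, he⟩ := h i j hij
        exact ⟨e.1, by simpa [hij] using e.2, he⟩
  choose f hf hfq using hf
  have hdet : (cayleyMenger fun i j => sqDist p (f s(i, j))).det = 0 := by
    simp only [hfq, sqDist_mk]
    refine det_cayleyMenger_of_not_affineIndependent fun hq => ?_
    have h1 := hq.card_le_finrank_succ
    have h2 := Submodule.finrank_le (vectorSpan ℝ (Set.range q))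
    rw [finrank_euclideanSpace_fin] at h2
    omega
  obtain ⟨ψ, hψ⟩ := exists_vertex_map (by omega) (hp.injOn_and_complete hd hι hf hdet).1
    (fun i j k => hp.exists_triangle hd hι hf hdet)
  refine ⟨ψ, fun i j => ?_⟩
  by_cases hij : i = j
  · subst hij; simp
  · have := hfq s(i, j)
    rw [hψ i j hij, sqDist_mk, sqDist_mk] at this
    exact ((sq_eq_sq₀ dist_nonneg dist_nonneg).1 this).symm

/-! ### Trilateration -/

/-- The trilateration step. The new point `q j` and the points `q r`, `r ∈ R`, are congruent to
points of `p`. The labels of the `q r` are unique since `R` has at least three elements, and the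
distances to them determine the position of `q j`. -/
lemma IsGeneric.exists_next_label {d n : ℕ} (hd : 2 ≤ d) {p : Configuration d n}
    (hp : IsGeneric p) {κ : Type*} [DecidableEq κ] {q : κ → EuclideanSpace ℝ (Fin d)}
    (hq : Function.Injective q) {φ : κ → Fin n} {s R : Finset κ}
    (hφ : ∀ i ∈ s, ∀ j ∈ s, dist (q i) (q j) = dist (p (φ i)) (p (φ j))) (hRs : R ⊆ s)
    (hR : R.card = d + 1) {j : κ} (hj : j ∉ s)
    (hm : ∀ r ∈ R, ∃ e : Edge n, sqLength p e = dist (q r) (q j) ^ 2) :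
    ∃ a, ∀ i ∈ s, dist (q i) (q j) = dist (p (φ i)) (p a) := by
  have hjR : j ∉ R := fun h => hj (hRs h)
  have hφinj : ∀ i ∈ s, ∀ j ∈ s, φ i = φ j → i = j := by
    intro i hi j hj h
    have := hφ i hi j hj
    rw [h, dist_self, dist_eq_zero] at this
    exact hq this
  have hedge : ∀ x ∈ insert j R, ∀ y ∈ insert j R, x ≠ y →
      ∃ e : Edge n, sqLength p e = dist (q x) (q y) ^ 2 := by
    intro x hx y hy hxy
    rw [Finset.mem_insert] at hx hy
    rcases hx with rfl | hx
    · rcases hy with rfl | hy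
      · exact absurd rfl hxy
      · rw [dist_comm]; exact hm y hy
    · rcases hy with rfl | hy
      · exact hm x hx
      · refine ⟨⟨s(φ x, φ y), fun h => hxy (hφinj x (hRs hx) y (hRs hy) (by simpa using h))⟩, ?_⟩
        rw [hφ x (hRs hx) y (hRs hy)]; rfl
  obtain ⟨ψ, hψ⟩ := hp.exists_labels (by omega) (ι := ↥(insert j R))
    (by rw [Fintype.card_coe, Finset.card_insert_of_notMem hjR, hR]) (fun x => q x)
    (fun x y hxy => hedge x x.2 y y.2 fun h => hxy (Subtype.ext h))
  have hsub : ∀ r ∈ R, r ∈ insert j R := fun r hr => Finset.mem_insert_of_mem hr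
  have hψinj : Function.Injective ψ := by
    intro x y h
    have := hψ x y
    rw [h, dist_self, dist_eq_zero] at this
    exact Subtype.ext (hq this)
  have hpair : ∀ r (hr : r ∈ R) t (ht : t ∈ R), r ≠ t →
      s(ψ ⟨r, hsub r hr⟩, ψ ⟨t, hsub t ht⟩) = s(φ r, φ t) := by
    intro r hr t ht hrt
    refine hp.sqDist_injective (by omega) ?_ ?_ ?_
    · rw [Sym2.mk_isDiag_iff]
      exact fun h => hrt (congrArg Subtype.val (hψinj h))
    · rw [Sym2.mk_isDiag_iff]
      exact fun h => hrt (hφinj r (hRs hr) t (hRs ht) h)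
    · rw [sqDist_mk, sqDist_mk, ← hψ, ← hφ r (hRs hr) t (hRs ht)]
  have hψφ : ∀ r (hr : r ∈ R), ψ ⟨r, hsub r hr⟩ = φ r := by
    intro r hr
    obtain ⟨t, ht, u, hu, htu⟩ := Finset.one_lt_card.1
      (show 1 < (R.erase r).card by rw [Finset.card_erase_of_mem hr, hR]; omega)
    rw [Finset.mem_erase] at ht hu
    have h1 := hpair r hr t ht.2 ht.1.symm
    have h2 := hpair r hr u hu.2 hu.1.symm
    have h3 : φ t ≠ φ u := fun h => htu (hφinj t (hRs ht.2) u (hRs hu.2) h)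
    rw [Sym2.eq_iff] at h1 h2
    grind
  refine ⟨ψ ⟨j, Finset.mem_insert_self j R⟩, fun i hi => ?_⟩
  obtain ⟨T, hT⟩ := areCongruent_of_dist_eq (ι := s) (x := fun i => p (φ i)) (y := fun i => q i)
    fun i j => (hφ i i.2 j j.2).symm
  have hind : AffineIndependent ℝ (p ∘ fun r : R => φ r) :=
    hp.affineIndependent (by omega) (by rw [Fintype.card_coe, hR])
      fun r t h => Subtype.ext (hφinj r (hRs r.2) t (hRs t.2) h)
  have hspan := hind.affineSpan_eq_top_iff_card_eq_finrank_add_one.2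
    (by rw [Fintype.card_coe, hR, finrank_euclideanSpace_fin])
  have heq : p (ψ ⟨j, Finset.mem_insert_self j R⟩) = T.symm (q j) := by
    rw [← AffineSubspace.perpBisector_eq_top, eq_top_iff, ← hspan, affineSpan_le]
    rintro _ ⟨r, rfl⟩
    rw [SetLike.mem_coe, AffineSubspace.mem_perpBisector_iff_dist_eq, ← T.isometry.dist_eq _
      (T.symm (q j)), T.apply_symm_apply]
    have h1 := hT ⟨r, hRs r.2⟩
    have h2 := hψ ⟨r, hsub r r.2⟩ ⟨j, Finset.mem_insert_self j R⟩
    simp only [Function.comp] at h1 ⊢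
    rw [h1, ← hψφ r r.2, ← h2]
  have h1 := hT ⟨i, hi⟩
  simp only at h1
  rw [heq, ← T.isometry.dist_eq (p (φ i)), T.apply_symm_apply, h1]

/-- Labels are found one vertex at a time along the trilateration order. -/
lemma IsGeneric.exists_labels_of_trilateration {d n m : ℕ} (hd : 2 ≤ d) {p : Configuration d n}
    (hp : IsGeneric p) {q : Configuration d m} (hq : Function.Injective q) (hm : d + 2 ≤ m)
    (hbase : ∀ i j : Fin m, i < j → (j : ℕ) < d + 2 →
      ∃ e : Edge n, sqLength p e = dist (q i) (q j) ^ 2)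
    (hstep : ∀ j : Fin m, d + 2 ≤ (j : ℕ) → ∃ R : Finset (Fin m), R.card = d + 1 ∧
      ∀ i ∈ R, i < j ∧ ∃ e : Edge n, sqLength p e = dist (q i) (q j) ^ 2) :
    ∃ φ : Fin m → Fin n, ∀ i j, dist (q i) (q j) = dist (p (φ i)) (p (φ j)) := by
  have key : ∀ l, d + 2 ≤ l → l ≤ m → ∃ φ : Fin m → Fin n, ∀ i j : Fin m, (i : ℕ) < l →
      (j : ℕ) < l → dist (q i) (q j) = dist (p (φ i)) (p (φ j)) := by
    intro l hl
    induction l, hl using Nat.le_induction with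
    | base =>
      intro _
      obtain ⟨ψ, hψ⟩ := hp.exists_labels (by omega) (ι := Fin (d + 2)) (by simp)
        (fun i => q (Fin.castLE hm i)) (by
          intro i j hij
          rcases lt_or_gt_of_ne hij with h | h
          · exact hbase (Fin.castLE hm i) (Fin.castLE hm j) h j.2
          · rw [dist_comm]
            exact hbase (Fin.castLE hm j) (Fin.castLE hm i) h i.2)
      refine ⟨fun i => if h : (i : ℕ) < d + 2 then ψ ⟨i, h⟩ else ψ 0, fun i j hi hj => ?_⟩
      simp only [dif_pos hi, dif_pos hj, ← hψ]
      rfl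
    | succ l hl ih =>
      intro hlm
      obtain ⟨φ, hφ⟩ := ih (by omega)
      obtain ⟨R, hR, hRj⟩ := hstep ⟨l, hlm⟩ hl
      obtain ⟨a, ha⟩ := hp.exists_next_label hd hq (s := Finset.univ.filter fun i => (i : ℕ) < l)
        (R := R) (j := ⟨l, hlm⟩) (φ := φ)
        (fun i hi j hj => hφ i j (by simpa using hi) (by simpa using hj))
        (fun r hr => by simpa [Fin.lt_def] using (hRj r hr).1) hR (by simp) (fun r hr => (hRj r hr).2)
      have ha' : ∀ i : Fin m, (i : ℕ) < l → dist (q i) (q ⟨l, hlm⟩) = dist (p (φ i)) (p a) :=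
        fun i hi => ha i (by simpa using hi)
      refine ⟨Function.update φ ⟨l, hlm⟩ a, fun i j hi hj => ?_⟩
      have hlt : ∀ i : Fin m, (i : ℕ) < l + 1 → i ≠ ⟨l, hlm⟩ → (i : ℕ) < l := fun i hi hne =>
        lt_of_le_of_ne (Nat.lt_succ_iff.1 hi) fun h => hne (Fin.ext h)
      by_cases hi' : i = ⟨l, hlm⟩
      · subst hi'
        by_cases hj' : j = ⟨l, hlm⟩
        · subst hj'; simp
        · rw [Function.update_self, Function.update_of_ne hj', dist_comm, ha' j (hlt j hj hj'),
            dist_comm]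
      · by_cases hj' : j = ⟨l, hlm⟩
        · subst hj'
          rw [Function.update_self, Function.update_of_ne hi', ha' i (hlt i hi hi')]
        · rw [Function.update_of_ne hi', Function.update_of_ne hj']
          exact hφ i j (hlt i hi hi') (hlt j hj hj')
  obtain ⟨φ, hφ⟩ := key m hm le_rfl
  exact ⟨φ, fun i j => hφ i j i.2 j.2⟩

/-- In an ensemble that allows for trilateration every vertex lies on an edge. -/
lemma AllowsTrilateration.mem_support {d n k : ℕ} {H : EdgeEnsemble n k}
    (hH : AllowsTrilateration d H) (i : Fin n) : i ∈ support H := by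
  obtain ⟨hn, σ, hbase, hstep⟩ := hH
  obtain ⟨j, rfl⟩ := σ.surjective i
  rcases lt_or_ge (j : ℕ) (d + 2) with hj | hj
  · by_cases hj0 : (j : ℕ) = 0
    · obtain ⟨t, ht⟩ := hbase j ⟨1, by omega⟩ (by rw [Fin.lt_def]; simp [hj0]) (by simp)
      exact ⟨t, by rw [ht]; simp⟩
    · obtain ⟨t, ht⟩ := hbase ⟨0, by omega⟩ j (by rw [Fin.lt_def]; simp; omega) hj
      exact ⟨t, by rw [ht]; simp⟩
  · obtain ⟨R, hR, hRj⟩ := hstep j hj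
    obtain ⟨r, hr⟩ := Finset.card_pos.1 (show 0 < R.card by omega)
    obtain ⟨t, ht⟩ := (hRj r hr).2
    exact ⟨t, by rw [ht]; simp⟩

end UnlabeledTrilateration

theorem theorem5p13 (d n n' k k' : ℕ) (hd : 2 ≤ d) (hn : d + 2 ≤ n)
    (p : UnlabeledTrilateration.Configuration d n)
    (hp : UnlabeledTrilateration.IsGeneric p)
    (G : UnlabeledTrilateration.EdgeEnsemble n k)
    (q : UnlabeledTrilateration.Configuration d n')
    (hq : Function.Injective q)
    (H : UnlabeledTrilateration.EdgeEnsemble n' k')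
    (hH : UnlabeledTrilateration.AllowsTrilateration d H)
    -- `J` selects the positions in `⟨G, p⟩²` of the (possibly reordered) subsequence `⟨H, q⟩²`
    (J : Fin k' → Fin k) (hJ : Function.Injective J)
    (hdata : UnlabeledTrilateration.sqData H q = UnlabeledTrilateration.sqData G p ∘ J) :
    -- `G ∘ J` is the subsequence `G⁻`, and `φ` is the vertex relabeling
    ∃ φ : Fin n' ≃ UnlabeledTrilateration.support (G ∘ J),
      UnlabeledTrilateration.AreCongruent (fun i => p (φ i)) q ∧
      ∀ t : Fin k', Sym2.map (fun i => (φ i : Fin n)) (H t).1 = ((G ∘ J) t).1 := by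
  open UnlabeledTrilateration in
  have hmeas : ∀ i j, ContainsEdge H i j →
      ∃ e : Edge n, sqLength p e = dist (q i) (q j) ^ 2 := by
    rintro i j ⟨t, ht⟩
    refine ⟨G (J t), (congrFun hdata t).symm.trans ?_⟩
    change sqDist q (H t).1 = _
    rw [ht, sqDist_mk]
  obtain ⟨hn', σ, hbase, hstep⟩ := id hH
  obtain ⟨φ', hφ'⟩ := hp.exists_labels_of_trilateration hd (hq.comp σ.injective) hn'
    (fun i j hij hj => hmeas _ _ (hbase i j hij hj))
    (fun j hj => by
      obtain ⟨R, hR, hRj⟩ := hstep j hj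
      exact ⟨R, hR, fun i hi => ⟨(hRj i hi).1, hmeas _ _ (hRj i hi).2⟩⟩)
  let φ : Fin n' → Fin n := φ' ∘ σ.symm
  have hφ : ∀ i j, dist (q i) (q j) = dist (p (φ i)) (p (φ j)) := by
    intro i j
    simpa [φ] using hφ' (σ.symm i) (σ.symm j)
  have hinj : Function.Injective φ := by
    intro i j h
    have := hφ i j
    rw [h, dist_self, dist_eq_zero] at this
    exact hq this
  have hedge : ∀ t, Sym2.map φ (H t).1 = ((G ∘ J) t).1 := by
    intro t
    refine hp.sqDist_injective (by omega) ?_ ((G ∘ J) t).2 ?_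
    · rw [Sym2.isDiag_map hinj]; exact (H t).2
    · have h1 : sqDist q (H t).1 = sqDist p ((G ∘ J) t).1 := congrFun hdata t
      rw [← h1]
      induction (H t).1 with
      | _ i j => rw [Sym2.map_mk, sqDist_mk, sqDist_mk, hφ]
  have hmem : ∀ i, φ i ∈ support (G ∘ J) := by
    intro i
    obtain ⟨t, ht⟩ := hH.mem_support i
    exact ⟨t, by rw [← hedge, Sym2.mem_map]; exact ⟨i, ht, rfl⟩⟩
  refine ⟨Equiv.ofBijective (fun i => ⟨φ i, hmem i⟩) ⟨fun i j h => hinj (congrArg Subtype.val h),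
    ?_⟩, areCongruent_of_dist_eq fun i j => (hφ i j).symm, hedge⟩
  rintro ⟨v, t, ht⟩
  rw [← hedge, Sym2.mem_map] at ht
  obtain ⟨i, -, rfl⟩ := ht
  exact ⟨i, rfl⟩
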